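/- Let $X$ be a real or complex Banach space which is separable or reflexive, let $Y$ be a closed subspace of $X$ with $\dim X/Y=\infty$, and let $\alpha$ be a cardinal number ($\dim$ denotes the cardinality of a Hamel basis). A quasicomplement of $Y$ is a closed subspace $Z$ of $X$ such that $Y\cap Z=\{0\}$ and $Y+Z$ is dense in $X$. We say that $Y$ is totally $\alpha$-quasicomplemented if $Y$ has a quasicomplement and, for every $\alpha$-dimensional subspace $F$ of $X$ with $F\cap Y=\{0\}$, there is a quasicomplement $Z$ of $Y$ with $F\subset Z$ and $\dim Z/F=\infty$. If $\alpha<\aleph_0$, then $Y$ is totally $\alpha$-quasicomplemented. Moreover, if $Y\neq\{0\}$ and $\alpha\le\dim X/Y$ (that is, there exist $\alpha$-dimensional subspaces $F$ with $F\cap Y=\{0\}$), then $Y$ is totally $\alpha$-quasicomplemented if and only if $\alpha<\aleph_0$. -/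

import Mathlib

open scoped Cardinal

/-- A normed space is reflexive if the canonical embedding into its bidual is surjective. -/
def IsReflexiveSpace (𝕜 X : Type*) [RCLike 𝕜] [NormedAddCommGroup X] [NormedSpace 𝕜 X] : Prop :=
  Function.Surjective (NormedSpace.inclusionInDoubleDual 𝕜 X)

section TVS

variable {𝕜 : Type*} {X : Type*} [Field 𝕜] [AddCommGroup X] [Module 𝕜 X] [TopologicalSpace X]

/-- The closed subspaces `Y` and `Z` are quasicomplements of each other: they meet only in `0`
and their sum is dense. -/
structure IsQuasicomplement (Y Z : Submodule 𝕜 X) : Prop where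
  isClosed_left : IsClosed (Y : Set X)
  isClosed_right : IsClosed (Z : Set X)
  inf_eq_bot : Y ⊓ Z = ⊥
  dense_sup : Dense ((Y ⊔ Z : Submodule 𝕜 X) : Set X)

/-- `Y` has a quasicomplement. -/
def IsQuasicomplemented (Y : Submodule 𝕜 X) : Prop :=
  ∃ Z : Submodule 𝕜 X, IsQuasicomplement Y Z

end TVS

/-- `Y` is totally `α`-quasicomplemented: it is quasicomplemented, and each `α`-dimensional
subspace `F` with `F ∩ Y = 0` lies in some quasicomplement `Z` of `Y` with `dim (Z / F) = ∞`. -/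
def IsTotallyQuasicomplemented {𝕜 : Type*} {X : Type*} [Field 𝕜] [AddCommGroup X] [Module 𝕜 X]
    [TopologicalSpace X] (α : Cardinal) (Y : Submodule 𝕜 X) : Prop :=
  IsQuasicomplemented Y ∧
    ∀ F : Submodule 𝕜 X, Module.rank 𝕜 F = α → F ⊓ Y = ⊥ →
      ∃ Z : Submodule 𝕜 X, IsQuasicomplement Y Z ∧ F ≤ Z ∧
        ℵ₀ ≤ Module.rank 𝕜 (↥Z ⧸ F.submoduleOf Z)

/-!
The proof reduces the positive part to one statement: in a Banach space `X` that is separable or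
reflexive, *every* closed subspace `V` has a quasicomplement. Given a finite-dimensional `F` with
`F ∩ Y = 0`, a quasicomplement `Z₀` of the closed subspace `Y + F` yields the quasicomplement
`Z = Z₀ + F` of `Y`. It has infinite dimension over `F`, since otherwise `Y + Z` would be closed,
hence equal to `X`, and `Y` would have finite codimension
(`isTotallyQuasicomplemented_of_forall_isQuasicomplemented`).

*Separable spaces.* One builds increasing finite-dimensional subspaces `E` of `X` and `Φ` of the
dual, with `Φ` vanishing on `E`, such that `E` is independent of `Y` and `Φ` is independent of the
annihilator of `Y`. Such a pair can be enlarged so that `Y + E` absorbs a given vector, or so that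
`Φ` contains a functional with given restriction to `Y`. Running through a dense sequence of vectors
and a sequence of functionals separating points makes the closure of the union of the `E` a
quasicomplement (`isQuasicomplemented_of_separableSpace`).

*Reflexive spaces.* The argument is by induction on the cardinality `κ` of a set with dense span. Call subspaces `A` of `X` and `B` of the dual adapted to `Y` if `B` norms `A`, `A` norms `B`,
and `A ∩ Y` norms the restrictions of `B` to `Y`. In a reflexive space such a pair gives
a contractive projection onto the closure of `A` along the common kernel of `B`, and the projection
maps `Y` to itself (`IsAdaptedPair.exists_projection`). Indexing a generating set by the initial
ordinal `ι` of `κ`, and attaching monotonically a countable adapted pair to each finite subset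
of `ι`, one obtains projections `P J` for all `J ⊆ ι`, monotone and continuous in `J`. Each
`P (Iic i) - P (Iio i)` is a projection whose range `W i` is generated by fewer than `κ` vectors, so
`Y ∩ W i` has a quasicomplement in `W i`. The closed span of these quasicomplements is
a quasicomplement of `Y` (`IsProjectionFamily.isQuasicomplemented`).

*Necessity.* For infinite `α ≤ dim X / Y` and `0 ≠ y ∈ Y`, take `α` vectors `e i` independent modulo
`Y` and scalars `c i ≠ 0` such that `c i • e i` tends to `0` along a sequence of indices. The span
`F` of the vectors `y + c i • e i` has dimension `α` and meets `Y` trivially, but `y` lies in its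
closure. So no closed subspace containing `F` meets `Y` trivially.
-/

/-! ### Compatible pairs and the separable case -/

section Separable
variable {𝕜 : Type*} {X : Type*} [RCLike 𝕜] [NormedAddCommGroup X] [NormedSpace 𝕜 X]

/-- Hahn–Banach for a point and a closed subspace, by way of the normed quotient. -/
theorem exists_strongDual_ne_zero_of_notMem {V : Submodule 𝕜 X} (hV : IsClosed (V : Set X)) {x : X}
    (hx : x ∉ V) : ∃ f : StrongDual 𝕜 X, (∀ v ∈ V, f v = 0) ∧ f x ≠ 0 := by
  have : IsClosed (V : Set X) := hV
  have hx' : (V.mkQ x : X ⧸ V) ≠ 0 := by simpa using hx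
  obtain ⟨g, hg⟩ := SeparatingDual.exists_ne_zero (R := 𝕜) hx'
  refine ⟨g.comp V.mkQL, fun v hv => ?_, hg⟩
  have : V.mkQ v = 0 := by simpa using hv
  change g (V.mkQ v) = 0
  rw [this, map_zero]

/-- The continuous linear functionals vanishing on `V`. -/
def continuousAnnihilator (V : Submodule 𝕜 X) : Submodule 𝕜 (StrongDual 𝕜 X) where
  carrier := {g | ∀ v ∈ V, g v = 0}
  add_mem' := fun {a b} ha hb v hv => by simp [ha v hv, hb v hv]
  zero_mem' := by simp
  smul_mem' := fun c a ha v hv => by simp [ha v hv]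

theorem mem_continuousAnnihilator {V : Submodule 𝕜 X} {g : StrongDual 𝕜 X} :
    g ∈ continuousAnnihilator V ↔ ∀ v ∈ V, g v = 0 := Iff.rfl

/-- If `W` separates the points of a finite-dimensional space `V`, each functional on `V` is given
by an element of `W`. -/
theorem exists_forall_eq_of_separating {K V W : Type*} [Field K] [AddCommGroup V] [Module K V]
    [AddCommGroup W] [Module K W] [FiniteDimensional K V] (B : V →ₗ[K] W →ₗ[K] K)
    (hB : ∀ v, (∀ w, B v w = 0) → v = 0) (ψ : V →ₗ[K] K) : ∃ w, ∀ v, B v w = ψ v := by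
  have hinj : Function.Injective B := by
    rw [injective_iff_map_eq_zero]
    exact fun v hv => hB v fun w => by rw [hv]; rfl
  obtain ⟨w, hw⟩ := LinearMap.flip_surjective_iff₁.mpr hinj ψ
  exact ⟨w, fun v => by rw [← hw]; rfl⟩

/-- Finite-dimensional subspaces `E` of `X` and `Φ` of the dual of `X` form a compatible pair for `Y`
if `E` meets `Y` trivially, `Φ` meets the annihilator of `Y` trivially, and `Φ` vanishes on `E`.
These are finite stages `E` of a quasicomplement of `Y`, with `Φ` witnessing that the closure of the
union of the stages still meets `Y` trivially. -/
structure IsCompatiblePair (Y E : Submodule 𝕜 X) (Φ : Submodule 𝕜 (StrongDual 𝕜 X)) : Prop where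
  finite_left : FiniteDimensional 𝕜 E
  finite_right : FiniteDimensional 𝕜 Φ
  eq_zero_of_mem : ∀ e ∈ E, e ∈ Y → e = 0
  eq_zero_of_forall : ∀ φ ∈ Φ, (∀ y ∈ Y, φ y = 0) → φ = 0
  annihilates : ∀ φ ∈ Φ, ∀ e ∈ E, φ e = 0

theorem IsCompatiblePair.exists_extend_left {Y E : Submodule 𝕜 X}
    {Φ : Submodule 𝕜 (StrongDual 𝕜 X)}
    (h : IsCompatiblePair Y E Φ) (z : X) :
    ∃ E', E ≤ E' ∧ IsCompatiblePair Y E' Φ ∧ z ∈ Y ⊔ E' := by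
  by_cases hz : z ∈ Y ⊔ E
  · exact ⟨E, le_rfl, h, hz⟩
  have := h.finite_left
  have := h.finite_right
  -- `z` is corrected by an element of `Y` on which all of `Φ` takes the same values as on `z`
  obtain ⟨y, hy⟩ := exists_forall_eq_of_separating (K := 𝕜) (V := Φ) (W := Y)
    (LinearMap.mk₂ 𝕜 (fun φ y => (φ : StrongDual 𝕜 X) y) (by simp) (by simp) (by simp) (by simp))
    (fun φ hφ => Subtype.ext (h.eq_zero_of_forall φ φ.2 fun y hy => hφ ⟨y, hy⟩))
    { toFun := fun φ => (φ : StrongDual 𝕜 X) z, map_add' := by simp, map_smul' := by simp }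
  refine ⟨E ⊔ 𝕜 ∙ (z - y), le_sup_left,
    ⟨inferInstance, h.finite_right, ?_, h.eq_zero_of_forall, ?_⟩, ?_⟩
  · intro x hx hxY
    obtain ⟨e, he, w, hw, rfl⟩ := Submodule.mem_sup.1 hx
    obtain ⟨c, rfl⟩ := Submodule.mem_span_singleton.1 hw
    by_cases hc : c = 0
    · subst hc
      simp only [zero_smul, add_zero] at hxY ⊢
      exact h.eq_zero_of_mem e he hxY
    · refine absurd ?_ hz
      have : z = ((y : X) + c⁻¹ • (e + c • (z - y))) + (-c⁻¹) • e := by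
        rw [smul_add, smul_smul, inv_mul_cancel₀ hc]
        module
      rw [this]
      exact Submodule.add_mem_sup (Y.add_mem y.2 (Y.smul_mem _ hxY)) (E.smul_mem _ he)
  · intro φ hφ x hx
    obtain ⟨e, he, w, hw, rfl⟩ := Submodule.mem_sup.1 hx
    obtain ⟨c, rfl⟩ := Submodule.mem_span_singleton.1 hw
    have := hy ⟨φ, hφ⟩
    simp only [LinearMap.mk₂_apply, LinearMap.coe_mk, AddHom.coe_mk] at this
    simp [h.annihilates φ hφ e he, this]
  · exact Submodule.mem_sup.2 ⟨y, y.2, z - y,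
      Submodule.mem_sup_right (Submodule.mem_span_singleton_self _), add_sub_cancel _ _⟩

theorem IsCompatiblePair.exists_extend_right {Y E : Submodule 𝕜 X}
    {Φ : Submodule 𝕜 (StrongDual 𝕜 X)} (hY : IsClosed (Y : Set X))
    (h : IsCompatiblePair Y E Φ) (f : StrongDual 𝕜 X) :
    ∃ Φ', Φ ≤ Φ' ∧ IsCompatiblePair Y E Φ' ∧ ∃ φ ∈ Φ', ∀ y ∈ Y, f y = φ y := by
  by_cases hf : ∃ φ ∈ Φ, ∀ y ∈ Y, f y = φ y
  · exact ⟨Φ, le_rfl, h, hf⟩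
  have := h.finite_left
  have := h.finite_right
  -- `f` is corrected by a functional vanishing on `Y` that agrees with `f` on `E`
  obtain ⟨g, hg⟩ := exists_forall_eq_of_separating (K := 𝕜) (V := E) (W := continuousAnnihilator Y)
    (LinearMap.mk₂ 𝕜 (fun e g => (g : StrongDual 𝕜 X) e) (by simp) (by simp) (by simp) (by simp))
    (fun e he => by
      by_contra hne
      have heY : (e : X) ∉ Y := fun hmem => hne (Subtype.ext (h.eq_zero_of_mem e e.2 hmem))
      obtain ⟨g, hg, hge⟩ := exists_strongDual_ne_zero_of_notMem hY heY
      exact hge (he ⟨g, mem_continuousAnnihilator.2 hg⟩))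
    (f.toLinearMap.comp E.subtype)
  have hgY : ∀ y ∈ Y, (g : StrongDual 𝕜 X) y = 0 := mem_continuousAnnihilator.1 g.2
  refine ⟨Φ ⊔ 𝕜 ∙ (f - g), le_sup_left,
    ⟨h.finite_left, inferInstance, h.eq_zero_of_mem, ?_, ?_⟩, f - g,
    Submodule.mem_sup_right (Submodule.mem_span_singleton_self _), fun y hy => ?_⟩
  · intro x hx hxY
    obtain ⟨φ, hφ, w, hw, rfl⟩ := Submodule.mem_sup.1 hx
    obtain ⟨c, rfl⟩ := Submodule.mem_span_singleton.1 hw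
    by_cases hc : c = 0
    · subst hc
      simp only [zero_smul, add_zero] at hxY ⊢
      exact h.eq_zero_of_forall φ hφ hxY
    · refine absurd ⟨(-c⁻¹) • φ, Φ.smul_mem _ hφ, fun y hy => ?_⟩ hf
      have := hxY y hy
      simp only [add_apply, smul_apply, sub_apply, hgY y hy, sub_zero, smul_eq_mul] at this ⊢
      field_simp
      linear_combination this
  · intro x hx e he
    obtain ⟨φ, hφ, w, hw, rfl⟩ := Submodule.mem_sup.1 hx
    obtain ⟨c, rfl⟩ := Submodule.mem_span_singleton.1 hw
    have := hg ⟨e, he⟩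
    simp only [LinearMap.mk₂_apply, LinearMap.comp_apply, Submodule.subtype_apply,
      ContinuousLinearMap.coe_coe] at this
    simp [h.annihilates φ hφ e he, this]
  · simp [hgY y hy]

/-- Alternately enlarging the two members of a compatible pair produces a quasicomplement as soon as
there are a dense sequence of vectors and a sequence of functionals separating the points of `Y`. -/
theorem exists_isQuasicomplement_of_countable {Y : Submodule 𝕜 X} (hY : IsClosed (Y : Set X))
    (z : ℕ → X) (hz : DenseRange z) (f : ℕ → StrongDual 𝕜 X)
    (hf : ∀ y ∈ Y, (∀ n, f n y = 0) → y = 0) : IsQuasicomplemented Y := by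
  let S := {p : Submodule 𝕜 X × Submodule 𝕜 (StrongDual 𝕜 X) // IsCompatiblePair Y p.1 p.2}
  have step : ∀ (n : ℕ) (p : S), ∃ q : S, p.1 ≤ q.1 ∧ z n ∈ Y ⊔ q.1.1 ∧
      ∃ φ ∈ q.1.2, ∀ y ∈ Y, f n y = φ y := by
    rintro n ⟨⟨E, Φ⟩, h⟩
    obtain ⟨E', hE, h', hz'⟩ := h.exists_extend_left (z n)
    obtain ⟨Φ', hΦ, h'', hφ⟩ := h'.exists_extend_right hY (f n)
    exact ⟨⟨(E', Φ'), h''⟩, ⟨hE, hΦ⟩, hz', hφ⟩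
  choose next hle hnz hnf using step
  have h0 : IsCompatiblePair Y (⊥ : Submodule 𝕜 X) (⊥ : Submodule 𝕜 (StrongDual 𝕜 X)) :=
    ⟨inferInstance, inferInstance, by simp, by simp, by simp⟩
  let s : ℕ → S := fun n => Nat.rec ⟨(⊥, ⊥), h0⟩ next n
  have hs : ∀ n, s (n + 1) = next n (s n) := fun n => rfl
  have hmono : Monotone fun n => (s n).1 := monotone_nat_of_le_succ fun n => by
    rw [hs]; exact hle n (s n)
  have hmonoE : Monotone fun n => (s n).1.1 := fun m n h => (hmono h).1
  let Z : Submodule 𝕜 X := (⨆ n, (s n).1.1).topologicalClosure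
  have hkill : ∀ n, ∀ φ ∈ (s n).1.2, ∀ x ∈ Z, φ x = 0 := by
    intro n φ hφ x hx
    have hZ : Z ≤ LinearMap.ker φ.toLinearMap := by
      refine Submodule.topologicalClosure_minimal _ (iSup_le fun m e he => ?_) φ.isClosed_ker
      exact (s (max n m)).2.annihilates φ ((hmono (le_max_left n m)).2 hφ) e
        ((hmono (le_max_right n m)).1 he)
    exact hZ hx
  refine ⟨Z, hY, Submodule.isClosed_topologicalClosure _, ?_, ?_⟩
  · rw [eq_bot_iff]
    rintro x ⟨hxY, hxZ⟩
    refine hf x hxY fun n => ?_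
    obtain ⟨φ, hφ, hφf⟩ := hnf n (s n)
    rw [hφf x hxY]
    exact hkill (n + 1) φ hφ x hxZ
  · refine hz.mono ?_
    rintro _ ⟨n, rfl⟩
    refine (sup_le_sup_left ?_ Y) (hnz n (s n))
    exact (le_iSup (fun n => (s n).1.1) (n + 1)).trans (Submodule.le_topologicalClosure _)

/-- The norms of the restrictions to `V` of a separable set of functionals are determined by
countably many vectors of `V`. -/
theorem exists_countable_norming {E : Set (StrongDual 𝕜 X)} (hE : TopologicalSpace.IsSeparable E)
    (V : Submodule 𝕜 X) : ∃ D : Set X, D.Countable ∧ D ⊆ V ∧ ∀ b ∈ E, ∀ M : ℝ, 0 ≤ M →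
      (∀ d ∈ D, ‖b d‖ ≤ M * ‖d‖) → ∀ v ∈ V, ‖b v‖ ≤ M * ‖v‖ := by
  obtain ⟨C, hC, hEC⟩ := hE
  -- the witnesses detect each rational `q` that fails to bound the norm of `c` on `V`
  have wit : ∀ (c : StrongDual 𝕜 X) (q : ℚ), ∃ v ∈ V,
      (∃ w ∈ V, (q : ℝ) * ‖w‖ < ‖c w‖) → (q : ℝ) * ‖v‖ < ‖c v‖ := by
    intro c q
    by_cases h : ∃ w ∈ V, (q : ℝ) * ‖w‖ < ‖c w‖
    · obtain ⟨w, hw, hlt⟩ := h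
      exact ⟨w, hw, fun _ => hlt⟩
    · exact ⟨0, V.zero_mem, fun h' => absurd h' h⟩
  choose w hwV hw using wit
  refine ⟨⋃ c ∈ C, Set.range (w c), hC.biUnion fun c _ => Set.countable_range _, ?_, ?_⟩
  · simp only [Set.iUnion_subset_iff, Set.range_subset_iff]
    exact fun c _ q => hwV c q
  intro b hb M hM hbound v hv
  have key : ∀ ε : ℝ, 0 < ε → ‖b v‖ ≤ (M + 2 * ε) * ‖v‖ := by
    intro ε hε
    obtain ⟨c, hcC, hcb⟩ := Metric.mem_closure_iff.1 (hEC hb) ε hε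
    rw [dist_eq_norm] at hcb
    have hdiff : ∀ x, ‖b x - c x‖ ≤ ε * ‖x‖ := fun x =>
      (((b - c).le_opNorm x).trans (mul_le_mul_of_nonneg_right hcb.le (norm_nonneg x)))
    have hcv : ‖c v‖ ≤ (M + ε) * ‖v‖ := by
      by_contra! hlt
      have hv0 : 0 < ‖v‖ := by
        rcases (norm_nonneg v).eq_or_lt with h0 | h0
        · have : v = 0 := norm_eq_zero.1 h0.symm
          simp [this] at hlt
        · exact h0
      obtain ⟨q, hq1, hq2⟩ := exists_rat_btwn ((lt_div_iff₀ hv0).2 hlt)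
      have h1 := hw c q ⟨v, hv, (lt_div_iff₀ hv0).1 hq2⟩
      have h2 := hbound (w c q) (Set.mem_biUnion hcC (Set.mem_range_self q))
      have h3 : ‖c (w c q)‖ ≤ ‖b (w c q)‖ + ‖b (w c q) - c (w c q)‖ := by
        have := norm_sub_le (b (w c q)) (b (w c q) - c (w c q))
        simpa using this
      have h4 := hdiff (w c q)
      have h5 : (M + ε) * ‖w c q‖ ≤ q * ‖w c q‖ :=
        mul_le_mul_of_nonneg_right hq1.le (norm_nonneg _)
      linarith
    have h3 : ‖b v‖ ≤ ‖c v‖ + ‖b v - c v‖ := by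
      have := norm_add_le (c v) (b v - c v)
      simpa using this
    linarith [hdiff v]
  have hlim : Filter.Tendsto (fun ε : ℝ => (M + 2 * ε) * ‖v‖) (nhdsWithin 0 (Set.Ioi 0))
      (nhds ((M + 2 * 0) * ‖v‖)) :=
    (Continuous.tendsto (by fun_prop) 0).mono_left nhdsWithin_le_nhds
  have := ge_of_tendsto hlim (by filter_upwards [self_mem_nhdsWithin] with ε hε using key ε hε)
  simpa using this

theorem exists_countable_norming_dual {E : Set X} (hE : TopologicalSpace.IsSeparable E) :
    ∃ C : Set (StrongDual 𝕜 X), C.Countable ∧ ∀ a ∈ E, ∀ M : ℝ, 0 ≤ M →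
      (∀ c ∈ C, ‖c a‖ ≤ M * ‖c‖) → ‖a‖ ≤ M := by
  obtain ⟨C, hC, -, h⟩ := exists_countable_norming
    (hE.image (NormedSpace.inclusionInDoubleDual 𝕜 X).continuous) ⊤
  refine ⟨C, hC, fun a ha M hM hb => ?_⟩
  refine NormedSpace.norm_le_dual_bound 𝕜 a hM fun f => ?_
  exact h _ (Set.mem_image_of_mem _ ha) M hM (fun c hc => hb c hc) f trivial

theorem isQuasicomplemented_of_separableSpace [TopologicalSpace.SeparableSpace X]
    {Y : Submodule 𝕜 X} (hY : IsClosed (Y : Set X)) : IsQuasicomplemented Y := by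
  obtain ⟨z, hz⟩ := TopologicalSpace.exists_dense_seq X
  obtain ⟨C, hC, h⟩ := exists_countable_norming_dual (𝕜 := 𝕜)
    (TopologicalSpace.IsSeparable.of_separableSpace (Set.univ : Set X))
  obtain ⟨f, hf⟩ := (hC.insert 0).exists_eq_range (Set.insert_nonempty _ _)
  refine exists_isQuasicomplement_of_countable hY z hz f fun y _ hy => ?_
  refine norm_le_zero_iff.1 (h y trivial 0 le_rfl fun c hc => ?_)
  obtain ⟨n, rfl⟩ : c ∈ Set.range f := hf ▸ Set.mem_insert_of_mem _ hc
  simp [hy n]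

end Separable

/-! ### Subspaces contained in quasicomplements -/

section Inclusion
variable {𝕜 : Type*} {X : Type*} [RCLike 𝕜] [NormedAddCommGroup X] [NormedSpace 𝕜 X]

/-- A quasicomplement of `Y ⊔ F`, enlarged by the finite-dimensional `F`, is a quasicomplement of
`Y`. Were it finite-dimensional over `F`, its sum with `Y` would be closed, hence all of `X`. -/
theorem isTotallyQuasicomplemented_of_forall_isQuasicomplemented
    (hq : ∀ V : Submodule 𝕜 X, IsClosed (V : Set X) → IsQuasicomplemented V)
    {Y : Submodule 𝕜 X} (hY : IsClosed (Y : Set X)) (hcodim : ℵ₀ ≤ Module.rank 𝕜 (X ⧸ Y))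
    {α : Cardinal} (hα : α < ℵ₀) : IsTotallyQuasicomplemented α Y := by
  refine ⟨hq Y hY, fun F hF hFY => ?_⟩
  have hfin : FiniteDimensional 𝕜 F := Module.rank_lt_aleph0_iff.1 (hF ▸ hα)
  obtain ⟨Z, hZ⟩ := hq (Y ⊔ F) (Submodule.isClosed_sup_finiteDimensional Y F hY)
  refine ⟨Z ⊔ F, ⟨hY, Submodule.isClosed_sup_finiteDimensional Z F hZ.isClosed_right, ?_, ?_⟩,
    le_sup_right, ?_⟩
  · rw [eq_bot_iff]
    rintro x ⟨hxY, hxZ⟩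
    obtain ⟨z, hz, f, hf, rfl⟩ := Submodule.mem_sup.1 hxZ
    have hz0 : z = 0 := by
      have : z ∈ (Y ⊔ F) ⊓ Z := by
        refine ⟨?_, hz⟩
        have : z = (z + f) + -f := by abel
        rw [this]
        exact Submodule.add_mem_sup hxY (F.neg_mem hf)
      simpa [hZ.inf_eq_bot] using this
    subst hz0
    rw [zero_add] at hxY ⊢
    exact hFY ▸ (⟨hf, hxY⟩ : f ∈ F ⊓ Y)
  · have : Y ⊔ (Z ⊔ F) = Y ⊔ F ⊔ Z := by rw [sup_comm Z F, sup_assoc]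
    rw [this]
    exact hZ.dense_sup
  · by_contra! hlt
    have h1 : FiniteDimensional 𝕜 (↥(Z ⊔ F) ⧸ F.submoduleOf (Z ⊔ F)) :=
      Module.rank_lt_aleph0_iff.1 hlt
    have h2 : FiniteDimensional 𝕜 (F.submoduleOf (Z ⊔ F)) :=
      (Submodule.submoduleOfEquivOfLe (le_sup_right : F ≤ Z ⊔ F)).symm.finiteDimensional
    have h3 : FiniteDimensional 𝕜 ↥(Z ⊔ F) :=
      Module.Finite.of_submodule_quotient (F.submoduleOf (Z ⊔ F))
    have h4 : FiniteDimensional 𝕜 Z := Submodule.finiteDimensional_of_le (le_sup_left : Z ≤ Z ⊔ F)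
    have hcl := Submodule.isClosed_sup_finiteDimensional (Y ⊔ F) Z hZ.isClosed_left
    have htop : Y ⊔ F ⊔ Z = ⊤ := by
      rw [← SetLike.coe_set_eq, ← hcl.closure_eq]
      exact hZ.dense_sup.closure_eq
    have hsurj : Function.Surjective (Y.mkQ.comp (Z ⊔ F).subtype) := by
      intro q
      obtain ⟨x, rfl⟩ := Y.mkQ_surjective q
      have hx : x ∈ Y ⊔ (Z ⊔ F) := by
        rw [sup_comm Z F, ← sup_assoc, htop]; trivial
      obtain ⟨y, hy, w, hw, rfl⟩ := Submodule.mem_sup.1 hx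
      exact ⟨⟨w, hw⟩, by simpa using hy⟩
    have h5 : FiniteDimensional 𝕜 (X ⧸ Y) := Module.Finite.of_surjective _ hsurj
    exact absurd hcodim (not_le.2 (Module.rank_lt_aleph0_iff.2 h5))

/-- Small multiples of vectors independent modulo `Y`, all translated by `y ∈ Y`, span a subspace
that meets `Y` trivially while its closure contains `y`. -/
theorem exists_rank_eq_inf_eq_bot_closure_meets {Y : Submodule 𝕜 X} {α : Cardinal} (hα : ℵ₀ ≤ α)
    (hle : α ≤ Module.rank 𝕜 (X ⧸ Y)) (y : X) (hy : y ∈ Y) :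
    ∃ F : Submodule 𝕜 X, Module.rank 𝕜 F = α ∧ F ⊓ Y = ⊥ ∧ y ∈ F.topologicalClosure := by
  obtain ⟨s, hs, hli⟩ := le_rank_iff_exists_linearIndependent.1 hle
  have hinf : Infinite s := Cardinal.infinite_iff.2 (hs ▸ hα)
  let g := Infinite.natEmbedding s
  -- the factors `r i` make the norm of `r i • e i` at most `1 / (n + 1)` at the `n`-th index `g n`
  let N : s → ℕ := Function.invFun g
  have hN : ∀ n, N (g n) = n := Function.leftInverse_invFun g.injective
  choose e he using fun i : s => Y.mkQ_surjective i
  let r : s → ℝ := fun i => 1 / ((N i + 1) * (1 + ‖e i‖))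
  have hr : ∀ i, 0 < r i := fun i => by positivity
  let c : s → 𝕜ˣ := fun i => Units.mk0 ((r i : ℝ) : 𝕜) (by simpa using (hr i).ne')
  let v : s → X := fun i => y + c i • e i
  have hv : Y.mkQ ∘ v = c • (fun i : s => (i : X ⧸ Y)) := by
    funext i
    have : Y.mkQ y = 0 := by simpa using hy
    simp only [v, Function.comp_apply, map_add, this, zero_add, Pi.smul_apply', Units.smul_def,
      map_smul, he]
  have hvli : LinearIndependent 𝕜 (Y.mkQ ∘ v) := by
    rw [hv]
    exact LinearIndependent.units_smul hli c
  refine ⟨Submodule.span 𝕜 (Set.range v), ?_, ?_, ?_⟩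
  · rw [rank_span (hvli.of_comp), Cardinal.mk_range_eq _ hvli.of_comp.injective, hs]
  · have := Submodule.range_ker_disjoint hvli
    rwa [Submodule.ker_mkQ, disjoint_iff] at this
  · refine mem_closure_of_tendsto (f := fun n => v (g n)) (b := Filter.atTop) ?_
      (Filter.Eventually.of_forall fun n => Submodule.subset_span (Set.mem_range_self _))
    rw [tendsto_iff_norm_sub_tendsto_zero]
    refine squeeze_zero (fun n => norm_nonneg _) (fun n => ?_)
      tendsto_one_div_add_atTop_nhds_zero_nat
    have h1 : v (g n) - y = ((r (g n) : ℝ) : 𝕜) • e (g n) := by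
      simp [v, c, Units.smul_def]
    rw [h1, norm_smul, RCLike.norm_ofReal, abs_of_pos (hr _)]
    simp only [r, hN]
    rw [one_div, mul_inv, ← one_div, mul_assoc]
    refine mul_le_of_le_one_right (by positivity) ?_
    rw [inv_mul_le_iff₀ (by positivity)]
    linarith

theorem not_isTotallyQuasicomplemented_of_aleph0_le {Y : Submodule 𝕜 X} {α : Cardinal}
    (hα : ℵ₀ ≤ α) (hle : α ≤ Module.rank 𝕜 (X ⧸ Y)) (hne : Y ≠ ⊥) :
    ¬ IsTotallyQuasicomplemented α Y := by
  obtain ⟨y, hy, hy0⟩ := Y.exists_mem_ne_zero_of_ne_bot hne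
  obtain ⟨F, hF, hFY, hyF⟩ := exists_rank_eq_inf_eq_bot_closure_meets hα hle y hy
  rintro ⟨-, h⟩
  obtain ⟨Z, hZ, hFZ, -⟩ := h F hF hFY
  have hyZ : y ∈ Z := F.topologicalClosure_minimal hFZ hZ.isClosed_right hyF
  exact hy0 ((Submodule.mem_bot 𝕜).1 (hZ.inf_eq_bot ▸ ⟨hy, hyZ⟩))

end Inclusion

/-! ### Adapted pairs and projections in reflexive spaces -/

section Adapted
variable {𝕜 : Type*} {X : Type*} [RCLike 𝕜] [NormedAddCommGroup X] [NormedSpace 𝕜 X]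

/-- A closed subspace of a reflexive space is reflexive. -/
theorem IsReflexiveSpace.submodule (hX : IsReflexiveSpace 𝕜 X) {W : Submodule 𝕜 X}
    (hW : IsClosed (W : Set X)) : IsReflexiveSpace 𝕜 W := by
  intro Φ
  let R : StrongDual 𝕜 X →L[𝕜] StrongDual 𝕜 W :=
    (ContinuousLinearMap.compL 𝕜 W X 𝕜).flip W.subtypeL
  have hR : ∀ f (w : W), R f w = f w := fun f w => rfl
  obtain ⟨x, hx⟩ := hX (Φ.comp R)
  have hx' : ∀ f : StrongDual 𝕜 X, f x = Φ (R f) := fun f => by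
    rw [← NormedSpace.dual_def 𝕜 X x f, hx]; rfl
  have hxW : x ∈ W := by
    by_contra hxW
    obtain ⟨f, hf, hfx⟩ := exists_strongDual_ne_zero_of_notMem hW hxW
    refine hfx ?_
    have : R f = 0 := ContinuousLinearMap.ext fun w => hf w w.2
    rw [hx', this, map_zero]
  refine ⟨⟨x, hxW⟩, ContinuousLinearMap.ext fun g => ?_⟩
  obtain ⟨f, hf, -⟩ := exists_extension_norm_eq W g
  have : R f = g := ContinuousLinearMap.ext fun w => hf w
  rw [NormedSpace.dual_def, ← hf, hx', this]

/-- Subspaces `A` of `X` and `B` of the dual of `X` are adapted to `Y` if `B` norms `A`, `A` norms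
`B`, and `A ⊓ Y` norms the restrictions of `B` to `Y`. Norming is expressed by saying that every
bound on the smaller set is a bound on the whole space; in this form it passes to directed
unions. -/
structure IsAdaptedPair (Y A : Submodule 𝕜 X) (B : Submodule 𝕜 (StrongDual 𝕜 X)) : Prop where
  norm_le : ∀ a ∈ A, ∀ M : ℝ, 0 ≤ M → (∀ b ∈ B, ‖b a‖ ≤ M * ‖b‖) → ‖a‖ ≤ M
  apply_le : ∀ b ∈ B, ∀ M : ℝ, 0 ≤ M → (∀ a ∈ A, ‖b a‖ ≤ M * ‖a‖) → ∀ x, ‖b x‖ ≤ M * ‖x‖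
  apply_le_of_mem : ∀ b ∈ B, ∀ M : ℝ, 0 ≤ M → (∀ a ∈ A, a ∈ Y → ‖b a‖ ≤ M * ‖a‖) →
    ∀ y ∈ Y, ‖b y‖ ≤ M * ‖y‖

theorem isAdaptedPair_bot (Y : Submodule 𝕜 X) : IsAdaptedPair Y ⊥ ⊥ where
  norm_le := by
    rintro a ha M hM -
    rw [(Submodule.mem_bot 𝕜).1 ha, norm_zero]; exact hM
  apply_le := by
    rintro b hb M hM - x
    rw [(Submodule.mem_bot 𝕜).1 hb, zero_apply, norm_zero]; positivity
  apply_le_of_mem := by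
    rintro b hb M hM - x -
    rw [(Submodule.mem_bot 𝕜).1 hb, zero_apply, norm_zero]; positivity

theorem IsAdaptedPair.iSup {Y : Submodule 𝕜 X} {σ : Type*} [Nonempty σ] {A : σ → Submodule 𝕜 X}
    {B : σ → Submodule 𝕜 (StrongDual 𝕜 X)} (hA : Directed (· ≤ ·) A) (hB : Directed (· ≤ ·) B)
    (h : ∀ s, IsAdaptedPair Y (A s) (B s)) : IsAdaptedPair Y (⨆ s, A s) (⨆ s, B s) where
  norm_le a ha M hM hb := by
    obtain ⟨s, hs⟩ := (Submodule.mem_iSup_of_directed A hA).1 ha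
    exact (h s).norm_le a hs M hM fun b hbs => hb b (Submodule.mem_iSup_of_mem s hbs)
  apply_le b hb M hM ha := by
    obtain ⟨s, hs⟩ := (Submodule.mem_iSup_of_directed B hB).1 hb
    exact (h s).apply_le b hs M hM fun a has => ha a (Submodule.mem_iSup_of_mem s has)
  apply_le_of_mem b hb M hM ha := by
    obtain ⟨s, hs⟩ := (Submodule.mem_iSup_of_directed B hB).1 hb
    exact (h s).apply_le_of_mem b hs M hM fun a has => ha a (Submodule.mem_iSup_of_mem s has)

/-- Countable sets are contained in countable sets spanning an adapted pair: one adds countably many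
norming witnesses, and repeats this infinitely often. -/
theorem exists_countable_isAdaptedPair (Y : Submodule 𝕜 X) {D : Set X} {C : Set (StrongDual 𝕜 X)}
    (hD : D.Countable) (hC : C.Countable) : ∃ D' C', D ⊆ D' ∧ C ⊆ C' ∧ D'.Countable ∧
      C'.Countable ∧ IsAdaptedPair Y (Submodule.span 𝕜 D') (Submodule.span 𝕜 C') := by
  let S := {p : Set X × Set (StrongDual 𝕜 X) // p.1.Countable ∧ p.2.Countable}
  have step : ∀ p : S, ∃ q : S, p.1 ≤ q.1 ∧
      (∀ a ∈ Submodule.span 𝕜 p.1.1, ∀ M : ℝ, 0 ≤ M → (∀ b ∈ q.1.2, ‖b a‖ ≤ M * ‖b‖) → ‖a‖ ≤ M) ∧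
      (∀ b ∈ Submodule.span 𝕜 p.1.2, ∀ M : ℝ, 0 ≤ M → (∀ a ∈ q.1.1, ‖b a‖ ≤ M * ‖a‖) →
        ∀ x, ‖b x‖ ≤ M * ‖x‖) ∧
      (∀ b ∈ Submodule.span 𝕜 p.1.2, ∀ M : ℝ, 0 ≤ M →
        (∀ a ∈ q.1.1, a ∈ Y → ‖b a‖ ≤ M * ‖a‖) → ∀ y ∈ Y, ‖b y‖ ≤ M * ‖y‖) := by
    rintro ⟨⟨D, C⟩, hD, hC⟩
    obtain ⟨C₁, hC₁, h₁⟩ := exists_countable_norming_dual (𝕜 := 𝕜) (hD.isSeparable.span (R := 𝕜))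
    obtain ⟨D₁, hD₁, -, h₂⟩ := exists_countable_norming (hC.isSeparable.span (R := 𝕜)) ⊤
    obtain ⟨D₂, hD₂, hD₂Y, h₃⟩ := exists_countable_norming (hC.isSeparable.span (R := 𝕜)) Y
    refine ⟨⟨(D ∪ (D₁ ∪ D₂), C ∪ C₁), hD.union (hD₁.union hD₂), hC.union hC₁⟩,
      ⟨Set.subset_union_left, Set.subset_union_left⟩, ?_, ?_, ?_⟩
    · exact fun a ha M hM hb => h₁ a ha M hM fun c hc => hb c (Or.inr hc)
    · exact fun b hb M hM ha x => h₂ b hb M hM (fun d hd => ha d (Or.inr (Or.inl hd))) x trivial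
    · exact fun b hb M hM ha => h₃ b hb M hM fun d hd => ha d (Or.inr (Or.inr hd)) (hD₂Y hd)
  choose next hle h₁ h₂ h₃ using step
  let s : ℕ → S := fun n => next^[n] ⟨(D, C), hD, hC⟩
  have hs : ∀ n, s (n + 1) = next (s n) := fun n => Function.iterate_succ_apply' _ _ _
  have hmono : Monotone fun n => (s n).1 := monotone_nat_of_le_succ fun n => by
    rw [hs]; exact hle (s n)
  have hdirA : Directed (· ≤ ·) fun n => Submodule.span 𝕜 (s n).1.1 :=
    Monotone.directed_le fun m n h => Submodule.span_mono (hmono h).1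
  have hdirB : Directed (· ≤ ·) fun n => Submodule.span 𝕜 (s n).1.2 :=
    Monotone.directed_le fun m n h => Submodule.span_mono (hmono h).2
  have hsubA : ∀ n, (next (s n)).1.1 ⊆ ⋃ n, (s n).1.1 := fun n => by
    rw [← hs]; exact Set.subset_iUnion (fun n => (s n).1.1) (n + 1)
  have hsubB : ∀ n, (next (s n)).1.2 ⊆ ⋃ n, (s n).1.2 := fun n => by
    rw [← hs]; exact Set.subset_iUnion (fun n => (s n).1.2) (n + 1)
  refine ⟨⋃ n, (s n).1.1, ⋃ n, (s n).1.2, Set.subset_iUnion (fun n => (s n).1.1) 0,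
    Set.subset_iUnion (fun n => (s n).1.2) 0, Set.countable_iUnion fun n => (s n).2.1,
    Set.countable_iUnion fun n => (s n).2.2, ?_, ?_, ?_⟩
  · intro a ha M hM hb
    rw [Submodule.span_iUnion] at ha
    obtain ⟨n, hn⟩ := (Submodule.mem_iSup_of_directed _ hdirA).1 ha
    exact h₁ (s n) a hn M hM fun b hb' => hb b (Submodule.subset_span (hsubB n hb'))
  · intro b hb M hM ha
    rw [Submodule.span_iUnion] at hb
    obtain ⟨n, hn⟩ := (Submodule.mem_iSup_of_directed _ hdirB).1 hb
    exact h₂ (s n) b hn M hM fun a ha' => ha a (Submodule.subset_span (hsubA n ha'))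
  · intro b hb M hM ha
    rw [Submodule.span_iUnion] at hb
    obtain ⟨n, hn⟩ := (Submodule.mem_iSup_of_directed _ hdirB).1 hb
    exact h₃ (s n) b hn M hM fun a ha' => ha a (Submodule.subset_span (hsubA n ha'))

/-- In a reflexive space, if `A ⊓ V` norms the restrictions of `B` to `V`, then `A ⊓ V` and the
vectors of `V` killed by `B` together span a dense subspace of `V`. -/
theorem IsReflexiveSpace.le_closure_sup (hX : IsReflexiveSpace 𝕜 X) {V A : Submodule 𝕜 X}
    {B : Submodule 𝕜 (StrongDual 𝕜 X)} (hV : IsClosed (V : Set X))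
    (h : ∀ b ∈ B, ∀ M : ℝ, 0 ≤ M → (∀ a ∈ A, a ∈ V → ‖b a‖ ≤ M * ‖a‖) →
      ∀ v ∈ V, ‖b v‖ ≤ M * ‖v‖) {T : Submodule 𝕜 X} (hT : IsClosed (T : Set X))
    (hA : A ⊓ V ≤ T) (hN : ∀ v ∈ V, (∀ b ∈ B, b v = 0) → v ∈ T) : V ≤ T := by
  intro v hv
  by_contra hvT
  obtain ⟨f, hf, hfv⟩ := exists_strongDual_ne_zero_of_notMem hT hvT
  -- by reflexivity, a functional killing the common zeros of `B` in `V` is a norm limit of sums of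
  -- elements of `B` and functionals vanishing on `V`
  have hmem : f ∈ (continuousAnnihilator V ⊔ B).topologicalClosure := by
    by_contra hnot
    obtain ⟨Φ, hΦ, hΦf⟩ := exists_strongDual_ne_zero_of_notMem
      (Submodule.isClosed_topologicalClosure _) hnot
    obtain ⟨x, rfl⟩ := hX Φ
    simp only [NormedSpace.dual_def] at hΦ hΦf
    have hle := Submodule.le_topologicalClosure (continuousAnnihilator V ⊔ B)
    have hxV : x ∈ V := by
      by_contra hxV
      obtain ⟨g, hg, hgx⟩ := exists_strongDual_ne_zero_of_notMem hV hxV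
      exact hgx (hΦ g (hle (Submodule.mem_sup_left (mem_continuousAnnihilator.2 hg))))
    exact hΦf (hf x (hN x hxV fun b hb => hΦ b (hle (Submodule.mem_sup_right hb))))
  have key : ∀ ε : ℝ, 0 < ε → ‖f v‖ ≤ ε * (2 * ‖v‖) := by
    intro ε hε
    obtain ⟨k, hk, hkf⟩ := Metric.mem_closure_iff.1 hmem ε hε
    obtain ⟨g, hg, b, hb, rfl⟩ := Submodule.mem_sup.1 hk
    rw [dist_eq_norm] at hkf
    have hd : ∀ x ∈ V, ‖f x - b x‖ ≤ ε * ‖x‖ := by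
      intro x hx
      have h1 := ((f - (g + b)).le_opNorm x).trans
        (mul_le_mul_of_nonneg_right hkf.le (norm_nonneg x))
      simpa [mem_continuousAnnihilator.1 hg x hx] using h1
    have hbv := h b hb ε hε.le (fun a ha haV => by
      simpa [hf a (hA ⟨ha, haV⟩)] using hd a haV) v hv
    have h3 : ‖f v‖ ≤ ‖b v‖ + ‖f v - b v‖ := by
      simpa using norm_add_le (b v) (f v - b v)
    linarith [hd v hv]
  refine hfv (norm_le_zero_iff.1 ?_)
  have hlim : Filter.Tendsto (fun ε : ℝ => ε * (2 * ‖v‖)) (nhdsWithin 0 (Set.Ioi 0))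
      (nhds (0 * (2 * ‖v‖))) :=
    (Continuous.tendsto (by fun_prop) 0).mono_left nhdsWithin_le_nhds
  rw [zero_mul] at hlim
  exact ge_of_tendsto hlim
    (by filter_upwards [self_mem_nhdsWithin] with ε hε using key ε hε)

/-- In a reflexive space an adapted pair `A`, `B` gives a bounded projection onto the closure of `A`
along the common kernel of `B`, and this projection leaves `Y` invariant. -/
theorem IsAdaptedPair.exists_projection [CompleteSpace X] (hX : IsReflexiveSpace 𝕜 X)
    {Y A : Submodule 𝕜 X} {B : Submodule 𝕜 (StrongDual 𝕜 X)} (hY : IsClosed (Y : Set X))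
    (h : IsAdaptedPair Y A B) : ∃ P : X →L[𝕜] X, (∀ a ∈ A, P a = a) ∧
      (∀ x, P x ∈ A.topologicalClosure) ∧ (∀ x, (∀ b ∈ B, b x = 0) → P x = 0) ∧
      (∀ x, ∀ b ∈ B, b (P x) = b x) ∧ ∀ y ∈ Y, P y ∈ Y := by
  let N : Submodule 𝕜 X := ⨅ b : B, LinearMap.ker (b : StrongDual 𝕜 X).toLinearMap
  have hNmem : ∀ x, x ∈ N ↔ ∀ b ∈ B, b x = 0 := fun x => by simp [N, Submodule.mem_iInf]
  have hNcl : IsClosed (N : Set X) := by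
    simp only [N, Submodule.coe_iInf]
    exact isClosed_iInter fun b => (b : StrongDual 𝕜 X).isClosed_ker
  have hbound : ∀ a ∈ A, ∀ n ∈ N, ‖a‖ ≤ ‖a + n‖ := fun a ha n hn =>
    h.norm_le a ha _ (norm_nonneg _) fun b hb => by
      have := b.le_opNorm (a + n)
      rwa [map_add, (hNmem n).1 hn b hb, add_zero, mul_comm] at this
  have hbound' : ∀ a ∈ A.topologicalClosure, ∀ n ∈ N, ‖a‖ ≤ ‖a + n‖ := by
    intro a ha n hn
    exact closure_minimal (t := {a : X | ‖a‖ ≤ ‖a + n‖}) (fun a ha => hbound a ha n hn)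
      (isClosed_le (by fun_prop) (by fun_prop)) ha
  let Ac := A.topologicalClosure
  have hdisj : Disjoint Ac N := by
    rw [Submodule.disjoint_def]
    intro x hx hxN
    have := hbound' x hx (-x) (N.neg_mem hxN)
    simpa using this
  -- addition is bounded below on `Ac × N`, so its range is closed
  have hclosed : IsClosed ((Ac ⊔ N : Submodule 𝕜 X) : Set X) := by
    have hAc : IsClosed (Ac : Set X) := A.isClosed_topologicalClosure
    have : CompleteSpace Ac := hAc.completeSpace_coe
    have : CompleteSpace N := hNcl.completeSpace_coe
    let g : Ac × N →L[𝕜] X := Ac.subtypeL.coprod N.subtypeL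
    have hg : AntilipschitzWith 2 g := by
      refine AddMonoidHomClass.antilipschitz_of_bound g fun p => ?_
      have h1 : ‖(p.1 : X)‖ ≤ ‖(p.1 : X) + p.2‖ := hbound' _ p.1.2 _ p.2.2
      have h2 : ‖(p.2 : X)‖ ≤ ‖(p.1 : X) + p.2‖ + ‖(p.1 : X)‖ := by
        simpa using norm_sub_le ((p.1 : X) + p.2) p.1
      have h3 : g p = (p.1 : X) + p.2 := rfl
      rw [h3, Prod.norm_def, max_le_iff]
      simp only [Submodule.coe_norm, NNReal.coe_ofNat]
      constructor <;> linarith [norm_nonneg ((p.1 : X) + p.2)]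
    have h1 := hg.isClosed_range g.uniformContinuous
    have h2 : Set.range g = ((Ac ⊔ N : Submodule 𝕜 X) : Set X) := by
      ext x
      simp only [Set.mem_range, SetLike.mem_coe, Submodule.mem_sup]
      constructor
      · rintro ⟨p, rfl⟩
        exact ⟨p.1, p.1.2, p.2, p.2.2, rfl⟩
      · rintro ⟨a, ha, n, hn, rfl⟩
        exact ⟨(⟨a, ha⟩, ⟨n, hn⟩), rfl⟩
    rwa [h2] at h1
  have hsup : Ac ⊔ N = ⊤ := top_le_iff.1 <|
    hX.le_closure_sup (V := ⊤) (A := A) (B := B) isClosed_univ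
      (fun b hb M hM ha v _ => h.apply_le b hb M hM (fun a haA => ha a haA trivial) v) hclosed
      (inf_le_left.trans (A.le_topologicalClosure.trans le_sup_left))
      (fun v _ hv => Submodule.mem_sup_right ((hNmem v).2 hv))
  have hc : IsCompl Ac N := ⟨hdisj, codisjoint_iff.2 hsup⟩
  let P₀ := Ac.projection N hc
  have hPmem : ∀ x, P₀ x ∈ Ac := fun x => Submodule.projection_apply_mem hc x
  have hPsub : ∀ x, x - P₀ x ∈ N := fun x => Submodule.sub_projection_mem hc x
  have hPA : ∀ a ∈ Ac, P₀ a = a := fun a ha => Submodule.projection_apply_left hc ⟨a, ha⟩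
  have hPN : ∀ n ∈ N, P₀ n = 0 := fun n hn => (Submodule.projection_apply_eq_zero_iff hc).2 hn
  let P : X →L[𝕜] X := P₀.mkContinuous 1 fun x => by
    simpa using hbound' (P₀ x) (hPmem x) _ (hPsub x)
  refine ⟨P, fun a ha => hPA a (A.le_topologicalClosure ha), hPmem,
    fun x hx => hPN x ((hNmem x).2 hx), fun x b hb => ?_, ?_⟩
  · have := (hNmem _).1 (hPsub x) b hb
    rw [map_sub, sub_eq_zero] at this
    exact this.symm
  · have hle : Y ≤ Y.comap P.toLinearMap := by
      refine hX.le_closure_sup hY h.apply_le_of_mem (hY.preimage P.continuous) ?_ ?_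
      · rintro a ⟨ha, haY⟩
        have : P a = a := hPA a (A.le_topologicalClosure ha)
        simpa [this] using haY
      · intro v _ hv
        have : P v = 0 := hPN v ((hNmem v).2 hv)
        simp [this]
    exact hle

end Adapted

/-! ### Long families of projections -/

section ProjectionFamily

/-- A family of bounded operators `P J`, for `J` a set of indices, such that `P J` and `P K` compose
to `P J` in either order whenever `J ⊆ K`, that leave `Y` invariant, with `P univ` the identity, and
that is continuous along lower sets: for a lower set `J`, both the closure of the range and the
kernel of `P J` are determined by the operators `P (Iic j)` with `j ∈ J`. The continuity applied to
`J = ∅` forces `P ∅ = 0`. -/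
structure IsProjectionFamily {𝕜 X ι : Type*} [RCLike 𝕜] [NormedAddCommGroup X] [NormedSpace 𝕜 X]
    [LinearOrder ι] (Y : Submodule 𝕜 X) (P : Set ι → X →L[𝕜] X) : Prop where
  apply_apply_of_subset_left : ∀ ⦃J K⦄, J ⊆ K → ∀ x, P K (P J x) = P J x
  apply_apply_of_subset_right : ∀ ⦃J K⦄, J ⊆ K → ∀ x, P J (P K x) = P J x
  mem_of_mem : ∀ J, ∀ y ∈ Y, P J y ∈ Y
  apply_univ : ∀ x, P Set.univ x = x
  mem_of_forall_mem : ∀ ⦃J⦄, IsLowerSet J → ∀ T : Submodule 𝕜 X, IsClosed (T : Set X) →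
    (∀ j ∈ J, ∀ x, P (Set.Iic j) x ∈ T) → ∀ x, P J x ∈ T
  eq_zero_of_forall : ∀ ⦃J⦄, IsLowerSet J → ∀ x, (∀ j ∈ J, P (Set.Iic j) x = 0) → P J x = 0

namespace IsProjectionFamily

variable {𝕜 X ι : Type*} [RCLike 𝕜] [NormedAddCommGroup X] [NormedSpace 𝕜 X]
    [LinearOrder ι] {Y : Submodule 𝕜 X} {P : Set ι → X →L[𝕜] X}

/-- The increment `P (Iic i) - P (Iio i)` is idempotent. -/
theorem increment_idem (h : IsProjectionFamily Y P) (i : ι) (x : X) :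
    (P (Set.Iic i) - P (Set.Iio i)) ((P (Set.Iic i) - P (Set.Iio i)) x) =
      (P (Set.Iic i) - P (Set.Iio i)) x := by
  have hsub : Set.Iio i ⊆ Set.Iic i := Set.Iio_subset_Iic_self
  simp only [sub_apply, map_sub, h.apply_apply_of_subset_left hsub,
    h.apply_apply_of_subset_right hsub, h.apply_apply_of_subset_left subset_rfl]
  abel

/-- Different increments annihilate each other. -/
theorem increment_increment (h : IsProjectionFamily Y P) {i j : ι} (hij : i ≠ j) (x : X) :
    (P (Set.Iic i) - P (Set.Iio i)) ((P (Set.Iic j) - P (Set.Iio j)) x) = 0 := by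
  rcases lt_or_gt_of_ne hij with hlt | hlt
  · have h1 : Set.Iic i ⊆ Set.Iio j := Set.Iic_subset_Iio.2 hlt
    have h2 : Set.Iio i ⊆ Set.Iio j := Set.Iio_subset_Iic_self.trans h1
    have h3 : Set.Iio j ⊆ Set.Iic j := Set.Iio_subset_Iic_self
    simp only [sub_apply, map_sub, h.apply_apply_of_subset_right h1,
      h.apply_apply_of_subset_right h2, h.apply_apply_of_subset_right (h1.trans h3),
      h.apply_apply_of_subset_right (h2.trans h3)]
    abel
  · have h1 : Set.Iic j ⊆ Set.Iio i := Set.Iic_subset_Iio.2 hlt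
    have h2 : Set.Iio j ⊆ Set.Iio i := Set.Iio_subset_Iic_self.trans h1
    have h3 : Set.Iio i ⊆ Set.Iic i := Set.Iio_subset_Iic_self
    simp only [sub_apply, map_sub, h.apply_apply_of_subset_left h1,
      h.apply_apply_of_subset_left h2, h.apply_apply_of_subset_left (h1.trans h3),
      h.apply_apply_of_subset_left (h2.trans h3)]
    abel

/-- If the part of `Y` in the range of each increment has a quasicomplement `Z i` in that range, then
the closed span of all `Z i` is a quasicomplement of `Y`: a common vector has vanishing increments,
hence is `0`, and by induction the ranges of all `P (Iic i)` lie in the closure of the sum. -/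
theorem isQuasicomplemented [WellFoundedLT ι] (h : IsProjectionFamily Y P)
    (hY : IsClosed (Y : Set X))
    (hZ : ∀ i, ∃ Z : Submodule 𝕜 X, IsClosed (Z : Set X) ∧
      (∀ z ∈ Z, (P (Set.Iic i) - P (Set.Iio i)) z = z) ∧ Y ⊓ Z = ⊥ ∧
      ∀ x, (P (Set.Iic i) - P (Set.Iio i)) x ∈ (Y ⊔ Z).topologicalClosure) :
    IsQuasicomplemented Y := by
  choose Z hZcl hZfix hZY hZdense using hZ
  let T : Submodule 𝕜 X := (⨆ i, Z i).topologicalClosure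
  have hQZ : ∀ i, ∀ x ∈ T, (P (Set.Iic i) - P (Set.Iio i)) x ∈ Z i := by
    intro i x hx
    have hle : T ≤ (Z i).comap (P (Set.Iic i) - P (Set.Iio i)).toLinearMap := by
      refine Submodule.topologicalClosure_minimal _ (iSup_le fun j z hz => ?_)
        ((hZcl i).preimage (P (Set.Iic i) - P (Set.Iio i)).continuous)
      rw [Submodule.mem_comap, ContinuousLinearMap.coe_coe]
      by_cases hij : i = j
      · subst hij
        rwa [hZfix i z hz]
      · rw [← hZfix j z hz, h.increment_increment hij]
        exact (Z i).zero_mem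
    exact hle hx
  refine ⟨T, hY, Submodule.isClosed_topologicalClosure _, ?_, ?_⟩
  · rw [eq_bot_iff]
    rintro x ⟨hxY, hxT⟩
    have hinc : ∀ i, P (Set.Iic i) x = P (Set.Iio i) x := by
      intro i
      have hmem : (P (Set.Iic i) - P (Set.Iio i)) x ∈ Y ⊓ Z i :=
        ⟨Y.sub_mem (h.mem_of_mem _ x hxY) (h.mem_of_mem _ x hxY), hQZ i x hxT⟩
      rw [hZY i] at hmem
      exact sub_eq_zero.1 ((Submodule.mem_bot 𝕜).1 hmem)
    have hzero : ∀ i, P (Set.Iic i) x = 0 := by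
      intro i
      induction i using WellFoundedLT.induction with
      | ind i ih =>
        rw [hinc]
        exact h.eq_zero_of_forall (isLowerSet_Iio i) x fun j hj => ih j hj
    rw [Submodule.mem_bot, ← h.apply_univ x]
    exact h.eq_zero_of_forall isLowerSet_univ x fun j _ => hzero j
  · let U := (Y ⊔ T).topologicalClosure
    have hUcl : IsClosed (U : Set X) := Submodule.isClosed_topologicalClosure _
    have hmem : ∀ i, ∀ x, P (Set.Iic i) x ∈ U := by
      intro i
      induction i using WellFoundedLT.induction with
      | ind i ih =>
        intro x
        have h1 : P (Set.Iio i) x ∈ U :=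
          h.mem_of_forall_mem (isLowerSet_Iio i) U hUcl (fun j hj => ih j hj) x
        have h2 : (P (Set.Iic i) - P (Set.Iio i)) x ∈ U :=
          Submodule.topologicalClosure_mono (sup_le_sup_left
            ((le_iSup Z i).trans (Submodule.le_topologicalClosure _)) Y) (hZdense i x)
        have h3 := U.add_mem h1 h2
        rwa [sub_apply, add_sub_cancel] at h3
    intro x
    have := h.mem_of_forall_mem isLowerSet_univ U hUcl (fun j _ => hmem j) x
    rw [h.apply_univ] at this
    exact this

end IsProjectionFamily

/-- Countable adapted pairs can be attached to the finite sets of indices in a monotone way, by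
recursion along strict inclusion. The empty set receives the zero pair, so that the closures
attached to initial segments are generated by the nonempty finite sets. -/
theorem exists_monotone_isAdaptedPair {𝕜 X ι : Type*} [RCLike 𝕜] [NormedAddCommGroup X]
    [NormedSpace 𝕜 X] (Y : Submodule 𝕜 X) (d : ι → X) :
    ∃ (D : Finset ι → Set X) (C : Finset ι → Set (StrongDual 𝕜 X)), Monotone D ∧ Monotone C ∧
      (∀ s, (D s).Countable) ∧ (∀ s, ∀ i ∈ s, d i ∈ D s) ∧ D ∅ = ∅ ∧ C ∅ = ∅ ∧
      ∀ s, IsAdaptedPair Y (Submodule.span 𝕜 (D s)) (Submodule.span 𝕜 (C s)) := by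
  classical
  have hull : ∀ p : Set X × Set (StrongDual 𝕜 X), ∃ q : Set X × Set (StrongDual 𝕜 X),
      p.1.Countable ∧ p.2.Countable → p ≤ q ∧ q.1.Countable ∧ q.2.Countable ∧
        IsAdaptedPair Y (Submodule.span 𝕜 q.1) (Submodule.span 𝕜 q.2) := by
    intro p
    by_cases hp : p.1.Countable ∧ p.2.Countable
    · obtain ⟨D', C', hD, hC, hD', hC', h⟩ := exists_countable_isAdaptedPair Y hp.1 hp.2
      exact ⟨(D', C'), fun _ => ⟨⟨hD, hC⟩, hD', hC', h⟩⟩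
    · exact ⟨p, fun h => absurd h hp⟩
  choose H hH using hull
  let step : (s : Finset ι) → ((t : Finset ι) → t < s → Set X × Set (StrongDual 𝕜 X)) →
      Set X × Set (StrongDual 𝕜 X) := fun s rec =>
    if s = ∅ then (∅, ∅) else
      H (d '' s ∪ ⋃ t : {t // t < s}, (rec t t.2).1, ⋃ t : {t // t < s}, (rec t t.2).2)
  let G : Finset ι → Set X × Set (StrongDual 𝕜 X) := wellFounded_lt.fix step
  have hG : ∀ s, G s = step s fun t _ => G t := fun s => WellFounded.fix_eq _ _ _
  have hG0 : G ∅ = (∅, ∅) := by rw [hG]; simp [step]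
  have hG1 : ∀ s ≠ ∅, G s =
      H (d '' s ∪ ⋃ t : {t // t < s}, (G t).1, ⋃ t : {t // t < s}, (G t).2) := fun s hs => by
    rw [hG]; simp [step, hs]
  have key : ∀ s : Finset ι, ((G s).1.Countable ∧ (G s).2.Countable) ∧
      (s ≠ ∅ → ((d '' s ∪ ⋃ t : {t // t < s}, (G t).1, ⋃ t : {t // t < s}, (G t).2) :
        Set X × Set (StrongDual 𝕜 X)) ≤ G s) ∧
      IsAdaptedPair Y (Submodule.span 𝕜 (G s).1) (Submodule.span 𝕜 (G s).2) := by
    intro s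
    induction s using WellFoundedLT.induction with
    | ind s ih =>
      by_cases hs : s = ∅
      · subst hs
        simp only [hG0, Submodule.span_empty]
        exact ⟨⟨Set.countable_empty, Set.countable_empty⟩, fun h => absurd rfl h,
          isAdaptedPair_bot Y⟩
      · have hfin : Finite {t // t < s} :=
          Finite.of_injective (fun t : {t // t < s} => (⟨t.1, Finset.mem_powerset.2 t.2.le⟩ :
            s.powerset)) fun a b hab => Subtype.ext (by simpa using hab)
        obtain ⟨h1, h2, h3, h4⟩ :=
          hH (d '' s ∪ ⋃ t : {t // t < s}, (G t).1, ⋃ t : {t // t < s}, (G t).2)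
            ⟨(s.countable_toSet.image d).union (Set.countable_iUnion fun t => (ih t t.2).1.1),
              Set.countable_iUnion fun t => (ih t t.2).1.2⟩
        rw [← hG1 s hs] at h1 h2 h3 h4
        exact ⟨⟨h2, h3⟩, fun _ => h1, h4⟩
  have hmono : Monotone G := by
    intro t s hts
    rcases hts.eq_or_lt with rfl | hlt
    · exact le_rfl
    have hs : s ≠ ∅ := fun hs => by subst hs; exact absurd hlt (by simp)
    exact ⟨fun x hx => ((key s).2.1 hs).1 (Or.inr (Set.mem_iUnion.2 ⟨⟨t, hlt⟩, hx⟩)),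
      fun x hx => ((key s).2.1 hs).2 (Set.mem_iUnion.2 ⟨⟨t, hlt⟩, hx⟩)⟩
  exact ⟨fun s => (G s).1, fun s => (G s).2, fun s t h => (hmono h).1, fun s t h => (hmono h).2,
    fun s => (key s).1.1, fun s i hi => ((key s).2.1 (Finset.ne_empty_of_mem hi)).1
      (Or.inl (Set.mem_image_of_mem d hi)), congrArg Prod.fst hG0, congrArg Prod.snd hG0,
    fun s => (key s).2.2⟩

theorem mk_finset_subset_lt {ι : Type*} {κ : Cardinal} (hκ : ℵ₀ < κ) {J : Set ι} (hJ : #J < κ) :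
    #{s : Finset ι // (s : Set ι) ⊆ J} < κ := by
  classical
  have h1 : #{s : Finset ι // (s : Set ι) ⊆ J} ≤ #(Finset J) := by
    refine Cardinal.mk_le_of_surjective (f := fun t : Finset J =>
      (⟨t.map (Function.Embedding.subtype _), by simp⟩ : {s : Finset ι // (s : Set ι) ⊆ J})) ?_
    rintro ⟨s, hs⟩
    exact ⟨s.subtype (· ∈ J), Subtype.ext (Finset.subtype_map_of_mem fun x hx => hs hx)⟩
  refine h1.trans_lt ?_
  rcases finite_or_infinite J with hfin | hinf
  · exact (Cardinal.lt_aleph0_of_finite _).trans hκ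
  · rwa [Cardinal.mk_finset_of_infinite]

end ProjectionFamily

/-! ### The reflexive case -/

section Reflexive

universe u v

/-- In a reflexive space a generating family indexed by a linear order gives a family of projections:
`P J` maps into the closed span of the countable sets attached to the finite subsets of `J`. -/
theorem exists_isProjectionFamily {𝕜 X ι : Type*} [RCLike 𝕜] [NormedAddCommGroup X]
    [NormedSpace 𝕜 X] [CompleteSpace X] [LinearOrder ι] (hX : IsReflexiveSpace 𝕜 X)
    {Y : Submodule 𝕜 X} (hY : IsClosed (Y : Set X)) (d : ι → X)
    (hd : Dense (Submodule.span 𝕜 (Set.range d) : Set X)) :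
    ∃ (P : Set ι → X →L[𝕜] X) (D : Finset ι → Set X), IsProjectionFamily Y P ∧
      (∀ s, (D s).Countable) ∧ ∀ J x, P J x ∈
        (Submodule.span 𝕜 (⋃ s : {s : Finset ι // (s : Set ι) ⊆ J}, D s)).topologicalClosure := by
  classical
  obtain ⟨D, C, hDmono, hCmono, hDc, hdD, hD0, hC0, hadapt⟩ := exists_monotone_isAdaptedPair Y d
  let σ : Set ι → Type _ := fun J => {s : Finset ι // (s : Set ι) ⊆ J}
  let A : Set ι → Submodule 𝕜 X := fun J => ⨆ s : σ J, Submodule.span 𝕜 (D s)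
  let B : Set ι → Submodule 𝕜 (StrongDual 𝕜 X) := fun J => ⨆ s : σ J, Submodule.span 𝕜 (C s)
  have hne : ∀ J, Nonempty (σ J) := fun J => ⟨⟨∅, by simp⟩⟩
  have hdir : ∀ J, Directed (· ≤ ·) fun s : σ J => (s : Finset ι) := fun J s t =>
    ⟨⟨s.1 ∪ t.1, by simpa using ⟨s.2, t.2⟩⟩, Finset.subset_union_left, Finset.subset_union_right⟩
  have hAB : ∀ J, IsAdaptedPair Y (A J) (B J) := fun J =>
    have := hne J
    IsAdaptedPair.iSup
      ((hdir J).mono_comp (g := fun s => Submodule.span 𝕜 (D s)) (· ≤ ·)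
        fun s t h => Submodule.span_mono (hDmono h))
      ((hdir J).mono_comp (g := fun s => Submodule.span 𝕜 (C s)) (· ≤ ·)
        fun s t h => Submodule.span_mono (hCmono h)) fun s => hadapt s
  have hAmono : Monotone A := fun J K h => iSup_le fun s =>
    le_iSup (fun s : σ K => Submodule.span 𝕜 (D s)) ⟨s.1, s.2.trans h⟩
  have hBmono : Monotone B := fun J K h => iSup_le fun s =>
    le_iSup (fun s : σ K => Submodule.span 𝕜 (C s)) ⟨s.1, s.2.trans h⟩
  choose P hPA hPmem hPzero hPB hPY using fun J => (hAB J).exists_projection hX hY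
  have hPA' : ∀ J, ∀ x ∈ (A J).topologicalClosure, P J x = x := fun J x hx =>
    closure_minimal (t := {x | P J x = x}) (fun x hx => hPA J x hx)
      (isClosed_eq (P J).continuous continuous_id) hx
  -- a nonempty finite subset of a lower set `J` lies in `Iic j` for its largest element `j`
  have hmax : ∀ {J : Set ι} (s : Finset ι), (s : Set ι) ⊆ J → s ≠ ∅ →
      ∃ j ∈ J, (s : Set ι) ⊆ Set.Iic j := fun s hs hne =>
    ⟨s.max' (Finset.nonempty_iff_ne_empty.2 hne), hs (Finset.max'_mem _ _),
      fun i hi => Finset.le_max' s i hi⟩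
  refine ⟨P, D, ⟨?_, ?_, hPY, ?_, ?_, ?_⟩, hDc, ?_⟩
  · exact fun J K h x => hPA' K _ (Submodule.topologicalClosure_mono (hAmono h) (hPmem J x))
  · intro J K h x
    rw [← sub_eq_zero, ← map_sub]
    refine hPzero J _ fun b hb => ?_
    rw [map_sub, hPB K x b (hBmono h hb), sub_self]
  · intro x
    have hle : Submodule.span 𝕜 (Set.range d) ≤ A Set.univ := by
      refine Submodule.span_le.2 ?_
      rintro _ ⟨i, rfl⟩
      exact Submodule.mem_iSup_of_mem (⟨{i}, by simp⟩ : σ Set.univ)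
        (Submodule.subset_span (hdD {i} i (by simp)))
    exact hPA' _ _ (hd.mono hle x)
  · intro J _ T hT hj x
    have hle : A J ≤ T := by
      refine iSup_le fun s => ?_
      by_cases hs : s.1 = ∅
      · simp [hs, hD0]
      obtain ⟨j, hjJ, hsj⟩ := hmax s.1 s.2 hs
      intro a ha
      rw [← hPA (Set.Iic j) a (Submodule.mem_iSup_of_mem (⟨s.1, hsj⟩ : σ (Set.Iic j)) ha)]
      exact hj j hjJ a
    exact Submodule.topologicalClosure_minimal _ hle hT (hPmem J x)
  · intro J _ x hj
    refine hPzero J x fun b hb => ?_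
    have hle : B J ≤ LinearMap.ker (NormedSpace.inclusionInDoubleDual 𝕜 X x).toLinearMap := by
      refine iSup_le fun s => ?_
      by_cases hs : s.1 = ∅
      · simp [hs, hC0]
      obtain ⟨j, hjJ, hsj⟩ := hmax s.1 s.2 hs
      intro b hb
      have := hPB (Set.Iic j) x b (Submodule.mem_iSup_of_mem (⟨s.1, hsj⟩ : σ (Set.Iic j)) hb)
      rw [hj j hjJ, map_zero] at this
      exact this.symm
    exact hle hb
  · intro J x
    rw [Submodule.span_iUnion]
    exact hPmem J x

/-- Induction on the cardinality of a set with dense span. The range `W` of an increment is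
generated by fewer vectors, because initial segments of the initial ordinal of `κ` have
cardinality less than `κ`. -/
theorem IsReflexiveSpace.isQuasicomplemented_of_mk_eq {𝕜 : Type v} [RCLike 𝕜] (κ : Cardinal.{u}) :
    ∀ (X : Type u) [NormedAddCommGroup X] [NormedSpace 𝕜 X] [CompleteSpace X],
      IsReflexiveSpace 𝕜 X → ∀ D : Set X, #D = κ → Dense (Submodule.span 𝕜 D : Set X) →
        ∀ Y : Submodule 𝕜 X, IsClosed (Y : Set X) → IsQuasicomplemented Y := by
  induction κ using WellFoundedLT.induction with
  | ind κ ih =>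
  intro X _ _ _ hX D hDκ hD Y hY
  rcases le_or_gt κ ℵ₀ with hκ | hκ
  · have hDc : D.Countable := Cardinal.le_aleph0_iff_set_countable.1 (hDκ ▸ hκ)
    have hsep := (hDc.isSeparable.span (R := 𝕜)).closure
    rw [hD.closure_eq] at hsep
    have := TopologicalSpace.isSeparable_univ_iff.1 hsep
    exact isQuasicomplemented_of_separableSpace hY
  let ι := κ.ord.ToType
  obtain ⟨e⟩ : Nonempty (ι ≃ D) :=
    Cardinal.eq.1 (by rw [Cardinal.mk_toType, Cardinal.card_ord, hDκ])
  let d : ι → X := fun i => e i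
  have hd : Set.range d = D := by
    rw [show d = Subtype.val ∘ e from rfl, Set.range_comp, e.range_eq_univ, Set.image_univ,
      Subtype.range_coe]
  obtain ⟨P, D', hP, hD'c, hPD'⟩ := exists_isProjectionFamily hX hY d (hd ▸ hD)
  refine hP.isQuasicomplemented hY fun i => ?_
  let Q := P (Set.Iic i) - P (Set.Iio i)
  have hQQ : ∀ x, Q (Q x) = Q x := hP.increment_idem i
  have hQY : ∀ y ∈ Y, Q y ∈ Y := fun y hy =>
    Y.sub_mem (hP.mem_of_mem _ y hy) (hP.mem_of_mem _ y hy)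
  have hQP : ∀ x, Q (P (Set.Iic i) x) = Q x := fun x => by
    simp only [Q, sub_apply, hP.apply_apply_of_subset_right Set.Iio_subset_Iic_self,
      hP.apply_apply_of_subset_right subset_rfl]
  let W : Submodule 𝕜 X := LinearMap.eqLocus Q.toLinearMap LinearMap.id
  have hWmem : ∀ x, x ∈ W ↔ Q x = x := fun x => LinearMap.mem_eqLocus
  have hW : IsClosed (W : Set X) := isClosed_eq Q.continuous continuous_id
  have : CompleteSpace W := hW.completeSpace_coe
  let R : X →L[𝕜] W := Q.codRestrict W fun x => (hWmem _).2 (hQQ x)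
  have hR : ∀ x, (R x : X) = Q x := fun x => rfl
  let E : Set X := ⋃ s : {s : Finset ι // (s : Set ι) ⊆ Set.Iic i}, D' s
  have hE : #(R '' E) < κ := by
    have hIic : #(Set.Iic i) < κ := by
      rw [← Set.Iio_insert]
      refine (Cardinal.mk_insert_le).trans_lt (Cardinal.add_lt_of_lt hκ.le ?_
        (Cardinal.one_lt_aleph0.trans hκ))
      simpa [ι] using Cardinal.mk_Iio_lt i (by simp [ι])
    refine Cardinal.mk_image_le.trans_lt ((Cardinal.mk_iUnion_le_sum_mk).trans_lt ?_)
    refine (Cardinal.sum_le_sum _ (fun _ => ℵ₀)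
      fun s : {s : Finset ι // (s : Set ι) ⊆ Set.Iic i} =>
        Cardinal.le_aleph0_iff_set_countable.2 (hD'c s)).trans_lt ?_
    rw [Cardinal.sum_const']
    exact Cardinal.mul_lt_of_lt hκ.le (mk_finset_subset_lt hκ hIic) hκ
  have hdense : Dense (Submodule.span 𝕜 (R '' E) : Set W) := by
    intro w
    have h1 : P (Set.Iic i) w ∈ closure (Submodule.span 𝕜 E : Set X) := hPD' _ _
    have h2 : R (P (Set.Iic i) w) = w := Subtype.ext (by rw [hR, hQP]; exact (hWmem _).1 w.2)
    have h3 := image_closure_subset_closure_image R.continuous (Set.mem_image_of_mem R h1)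
    rw [h2] at h3
    have h4 : R '' (Submodule.span 𝕜 E : Set X) = (Submodule.span 𝕜 (R '' E) : Set W) := by
      rw [← ContinuousLinearMap.coe_coe, ← Submodule.map_span, Submodule.map_coe]
    rwa [h4] at h3
  obtain ⟨Z, hZ⟩ := ih _ hE W (hX.submodule hW) _ rfl hdense (Y.comap W.subtype)
    (hY.preimage continuous_subtype_val)
  refine ⟨Z.map W.subtype, hW.isClosedEmbedding_subtypeVal.isClosedMap _ hZ.isClosed_right,
    ?_, ?_, fun x => ?_⟩
  · rintro _ ⟨z, _, rfl⟩
    exact (hWmem _).1 z.2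
  · rw [eq_bot_iff]
    rintro _ ⟨hzY, z, hz, rfl⟩
    have : z ∈ Y.comap W.subtype ⊓ Z := ⟨hzY, hz⟩
    rw [hZ.inf_eq_bot, Submodule.mem_bot] at this
    simp [this]
  · have h1 := image_closure_subset_closure_image (continuous_subtype_val (p := (· ∈ W)))
      (Set.mem_image_of_mem _ (hZ.dense_sup (R x)))
    refine closure_mono ?_ h1
    rintro _ ⟨w, hw, rfl⟩
    obtain ⟨y, hy, z, hz, rfl⟩ := Submodule.mem_sup.1 hw
    exact Submodule.add_mem_sup hy (Submodule.mem_map_of_mem hz)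

end Reflexive

/-! ### The characterization -/

theorem mainTheorem1 {𝕜 : Type*} {X : Type*} [RCLike 𝕜] [NormedAddCommGroup X] [NormedSpace 𝕜 X]
    [CompleteSpace X] (hX : TopologicalSpace.SeparableSpace X ∨ IsReflexiveSpace 𝕜 X)
    (Y : Submodule 𝕜 X) (hYclosed : IsClosed (Y : Set X))
    (hYcodim : ℵ₀ ≤ Module.rank 𝕜 (X ⧸ Y)) (α : Cardinal) :
    (α < ℵ₀ → IsTotallyQuasicomplemented α Y) ∧
      (Y ≠ ⊥ → α ≤ Module.rank 𝕜 (X ⧸ Y) →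
        (IsTotallyQuasicomplemented α Y ↔ α < ℵ₀)) := by
  have hq : ∀ V : Submodule 𝕜 X, IsClosed (V : Set X) → IsQuasicomplemented V := by
    intro V hV
    rcases hX with hsep | hrefl
    · exact isQuasicomplemented_of_separableSpace hV
    · exact hrefl.isQuasicomplemented_of_mk_eq _ X Set.univ rfl (by simp) V hV
  have hfin : α < ℵ₀ → IsTotallyQuasicomplemented α Y :=
    isTotallyQuasicomplemented_of_forall_isQuasicomplemented hq hYclosed hYcodim
  refine ⟨hfin, fun hne hle => ⟨fun h => ?_, hfin⟩⟩
  by_contra! hα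
  exact not_isTotallyQuasicomplemented_of_aleph0_le hα hle hne h
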